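/- Let $s\ge 2$, let $Q\cong\mathbb{Z}^s$ be a (multiplicatively written) free abelian group of rank $s$, let $I$ be an ideal of the integral group ring $\mathbb{Z}Q$, and let $A=\mathbb{Z}Q/I$. Suppose that $A$ is an integral domain of characteristic zero and of Krull dimension $2$, and that for every non-trivial element $q\in Q$ the image of $q$ in $A$ is not algebraic over $\mathbb{Q}$ (as an element of the field of fractions of $A$). Then $A$ is $Q$-homothety rigid, that is: whenever $x_1,\dots,x_s\in Q$ satisfy $Q=\langle x_1,\dots,x_s\rangle$ and $n,c_1,\dots,c_s$ are positive integers for which there is a ring homomorphism $$\mathbb{Z}\langle x_1^{n},\dots,x_s^{n}\rangle/\big(\mathbb{Z}\langle x_1^{n},\dots,x_s^{n}\rangle\cap I\big)\longrightarrow \mathbb{Z}\langle x_1^{c_1},\dots,x_s^{c_s}\rangle/\big(\mathbb{Z}\langle x_1^{c_1},\dots,x_s^{c_s}\rangle\cap I\big)$$ sending (the class of) $x_i^{n}$ to (the class of) $x_i^{c_i}$ for all $1\le i\le s$, one has $n=c_1=\dots=c_s$. -/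

import Mathlib

/-- For a subgroup `H ≤ Q` and an ideal `I` of `ℤQ`, the ideal `ℤH ∩ I` of the group ring `ℤH`
(the preimage of `I` under the inclusion `ℤH → ℤQ`). -/
noncomputable def interIdeal {Q : Type*} [CommGroup Q] (I : Ideal (MonoidAlgebra ℤ Q))
    (H : Subgroup Q) : Ideal (MonoidAlgebra ℤ H) :=
  I.comap (MonoidAlgebra.mapDomainRingHom ℤ H.subtype)

/-- The ring `ℤH / (ℤH ∩ I)`. -/
abbrev SubQuot {Q : Type*} [CommGroup Q] (I : Ideal (MonoidAlgebra ℤ Q)) (H : Subgroup Q) :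
    Type _ :=
  MonoidAlgebra ℤ H ⧸ interIdeal I H

/-- The image of the group element `h ∈ H` in `ℤH / (ℤH ∩ I)`. -/
noncomputable def SubQuot.elt {Q : Type*} [CommGroup Q] (I : Ideal (MonoidAlgebra ℤ Q))
    (H : Subgroup Q) (h : H) : SubQuot I H :=
  Ideal.Quotient.mk (interIdeal I H) (MonoidAlgebra.of ℤ H h)

/-- The subgroup `⟨x₁^{e₁}, …, x_s^{e_s}⟩` of `Q`. -/
def powSubgroup {Q : Type*} [CommGroup Q] {s : ℕ} (x : Fin s → Q) (e : Fin s → ℕ) :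
    Subgroup Q :=
  Subgroup.closure (Set.range fun i => x i ^ e i)

/-- `x_i^{e_i}` as an element of `⟨x₁^{e₁}, …, x_s^{e_s}⟩`. -/
def powElt {Q : Type*} [CommGroup Q] {s : ℕ} (x : Fin s → Q) (e : Fin s → ℕ) (i : Fin s) :
    powSubgroup x e :=
  ⟨x i ^ e i, Subgroup.subset_closure ⟨i, rfl⟩⟩

/-- `A = ℤQ / I` is `Q`-homothety rigid, where `Q` is free abelian of rank `s`: whenever
`Q = ⟨x₁, …, x_s⟩` and `n, c₁, …, c_s` are positive integers for which there is a ring homomorphism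
`ℤ⟨x_i^n⟩ / (ℤ⟨x_i^n⟩ ∩ I) → ℤ⟨x_i^{c_i}⟩ / (ℤ⟨x_i^{c_i}⟩ ∩ I)` that sends `x_i^n` to `x_i^{c_i}`
for all `i`, one has `n = c₁ = … = c_s`. -/
def IsHomothetyRigid {Q : Type*} [CommGroup Q] (I : Ideal (MonoidAlgebra ℤ Q)) : Prop :=
  ∀ s : ℕ, Nonempty (Q ≃* Multiplicative (Fin s → ℤ)) →
    ∀ x : Fin s → Q, Subgroup.closure (Set.range x) = ⊤ →
    ∀ (n : ℕ) (c : Fin s → ℕ), 0 < n → (∀ i, 0 < c i) →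
    (∃ φ : SubQuot I (powSubgroup x fun _ => n) →+* SubQuot I (powSubgroup x c),
      ∀ i, φ (SubQuot.elt I _ (powElt x (fun _ => n) i)) = SubQuot.elt I _ (powElt x c i)) →
    ∀ i, c i = n

/-- An element `a` of a domain `A` of characteristic zero is algebraic over `ℚ`: it is so in the
field of fractions of `A`. -/
def IsAlgebraicOverRat {A : Type*} [CommRing A] [IsDomain A] [CharZero A] (a : A) : Prop :=
  IsAlgebraic ℚ (algebraMap A (FractionRing A) a)

/-! The fraction field of `A` has transcendence degree at most one over ℚ, since one step of the
Krull dimension is spent on an integer prime (`Algebra.trdeg_le_one_of_ringKrullDim_le_two`). A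
kernel would make the images of the `x_i` algebraic, so the given map is injective and extends to an
endomorphism σ of the algebraic closure Ω, with σ(a_i^n) = a_i^{c_i}, where a_i is the image of x_i.

Take a derivation D of Ω with D a_k = a_k and write D a_j = r a_j for some j ≠ k. If D r = 0, the
monomials in a_j, a_k would be eigenvectors of D with distinct eigenvalues, so a_j and a_k would be
algebraically independent, which is impossible; hence r is transcendental. In transcendence degree
one, σD and Dσ are proportional; comparing them at a_k^n and a_j^n gives σ(r) = (c_j/c_k) r, so ℚ(σ
r) = ℚ(r).

This field calibrates degrees. Put t = a_i, c = c_i, M = ℚ(t, r). The fields ℚ(t^n, r) and its image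
ℚ(t^c, r) have the same degree over ℚ(r), so M has the same degree over both. Counting instead over
ℚ(t^n) and ℚ(t^c) gives n[M : ℚ(t)] = c[M : ℚ(t)], whence n = c. -/

/-- In transcendence degree at most one, a transcendental element is a transcendence basis. -/
theorem Transcendental.isTranscendenceBasis_of_trdeg_le_one {R A : Type*} [CommRing R] [CommRing A]
    [Nontrivial R] [Algebra R A] [IsDomain A] {t : A} (ht : Transcendental R t)
    (h : Algebra.trdeg R A ≤ 1) :
    IsTranscendenceBasis R fun _ : Unit => t :=
  (algebraicIndependent_unique_type_iff.2 ht).isTranscendenceBasis_of_lift_trdeg_le_of_finite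
    (by simpa using h)

open IntermediateField in
theorem Transcendental.isAlgebraic_adjoin_simple_of_trdeg_le_one {F K : Type*} [Field F] [Field K]
    [Algebra F K] {t : K} (ht : Transcendental F t) (h : Algebra.trdeg F K ≤ 1) :
    Algebra.IsAlgebraic F⟮t⟯ K := by
  have := (ht.isTranscendenceBasis_of_trdeg_le_one h).isAlgebraic_field
  rwa [Set.range_const] at this

/-! ### Derivations in transcendence degree one -/

namespace Derivation

variable {F K : Type*} [Field F] [Field K] [Algebra F K]

/-- The constants of a derivation of a field. -/
def constants {M : Type*} [AddCommGroup M] [Module K M] [Module F M] (D : Derivation F K M) :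
    IntermediateField F K where
  carrier := {x | D x = 0}
  mul_mem' {x y} (hx : D x = 0) (hy : D y = 0) :=
    show D (x * y) = 0 by rw [D.leibniz, hx, hy, smul_zero, smul_zero, add_zero]
  add_mem' {x y} (hx : D x = 0) (hy : D y = 0) :=
    show D (x + y) = 0 by rw [map_add, hx, hy, add_zero]
  algebraMap_mem' r := D.map_algebraMap r
  inv_mem' x (hx : D x = 0) := show D x⁻¹ = 0 by rw [D.leibniz_inv, hx, smul_zero]

theorem mem_constants {M : Type*} [AddCommGroup M] [Module K M] [Module F M]
    {D : Derivation F K M} {x : K} : x ∈ D.constants ↔ D x = 0 := Iff.rfl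

/-- A derivation is linear over every field of constants. -/
def extendConstants {M : Type*} [AddCommGroup M] [Module K M] [Module F M]
    (D : Derivation F K M) (L : IntermediateField F K) (hL : L ≤ D.constants) :
    Derivation L K M :=
  Derivation.mk'
    { toFun := D
      map_add' := D.map_add
      map_smul' := fun r x => by
        rw [Algebra.smul_def, D.leibniz, IntermediateField.algebraMap_apply,
          mem_constants.1 (hL r.2), smul_zero, add_zero]
        rfl }
    D.leibniz

/-- In characteristic zero, the field of constants is algebraically closed in the field. -/
theorem apply_eq_zero_of_isAlgebraic {M : Type*} [CharZero F] [AddCommGroup M] [Module K M]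
    [Module F M] [IsScalarTower F K M] (D : Derivation F K M) {b : K} (hb : IsAlgebraic F b) :
    D b = 0 := by
  have h := D.map_aeval (minpoly F b) b
  rw [minpoly.aeval, map_zero, eq_comm, smul_eq_zero] at h
  exact h.resolve_left ((minpoly.irreducible
    hb.isIntegral).separable.aeval_derivative_ne_zero (minpoly.aeval _ b))

open IntermediateField in
/-- A derivation killing `t` vanishes on every field algebraic over `F(t)`. -/
theorem eq_zero_of_isAlgebraic_adjoin_simple {M : Type*} [CharZero F] [AddCommGroup M] [Module K M]
    [Module F M] [IsScalarTower F K M] (D : Derivation F K M) {t : K} (ht : D t = 0)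
    [Algebra.IsAlgebraic F⟮t⟯ K] : D = 0 := by
  ext b
  exact (D.extendConstants F⟮t⟯ (adjoin_simple_le_iff.2 ht)).apply_eq_zero_of_isAlgebraic
    (Algebra.IsAlgebraic.isAlgebraic b)

/-- The derivation `d/dt` of a field of transcendence degree one. -/
theorem exists_apply_eq_one [CharZero F] (hK : Algebra.trdeg F K ≤ 1) {t : K}
    (ht : Transcendental F t) : ∃ D : Derivation F K K, D t = 1 := by
  -- Let X act as t. Then K is formally étale over F[X] (a localization followed by a separable
  -- algebraic extension), so Ω_{K/F} is K ⊗ Ω_{F[X]/F} and d/dX extends to K.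
  let : Algebra (Polynomial F) K := (Polynomial.aeval (R := F) t).toRingHom.toAlgebra
  have : IsScalarTower F (Polynomial F) K :=
    IsScalarTower.of_algebraMap_eq fun r => ((Polynomial.aeval (R := F) t).commutes r).symm
  have : FaithfulSMul (Polynomial F) K :=
    (faithfulSMul_iff_algebraMap_injective _ _).2 (transcendental_iff_injective.1 ht)
  have hX : algebraMap (Polynomial F) K Polynomial.X = t := Polynomial.aeval_X t
  let := FractionRing.liftAlgebra (Polynomial F) K
  have := FractionRing.isScalarTower_liftAlgebra (Polynomial F) K
  have : Algebra.IsAlgebraic (Polynomial F) K :=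
    (ht.isTranscendenceBasis_of_trdeg_le_one hK).isAlgebraic_iff.2 fun _ =>
      hX ▸ isAlgebraic_algebraMap _
  have : Algebra.IsAlgebraic (FractionRing (Polynomial F)) K :=
    (IsFractionRing.comap_isAlgebraic_iff (A := Polynomial F)).1 inferInstance
  have : CharZero (FractionRing (Polynomial F)) :=
    charZero_of_injective_algebraMap (IsFractionRing.injective (Polynomial F) _)
  have := Algebra.FormallyEtale.of_isSeparable (FractionRing (Polynomial F)) K
  have := Algebra.FormallyEtale.of_isLocalization (R := Polynomial F)
    (Rₘ := FractionRing (Polynomial F)) (nonZeroDivisors (Polynomial F))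
  have : Algebra.FormallyEtale (Polynomial F) K :=
    Algebra.FormallyEtale.comp _ (FractionRing (Polynomial F)) _
  let e := KaehlerDifferential.tensorKaehlerEquivOfFormallyEtale F (Polynomial F) K
  let l : TensorProduct (Polynomial F) K (KaehlerDifferential F (Polynomial F)) →ₗ[K] K :=
    (TensorProduct.AlgebraTensorModule.rid (Polynomial F) K K).toLinearMap ∘ₗ
      (KaehlerDifferential.polynomialEquiv F).toLinearMap.baseChange K
  refine ⟨(l ∘ₗ e.symm.toLinearMap).compDer (KaehlerDifferential.D F K), ?_⟩
  have := KaehlerDifferential.tensorKaehlerEquivOfFormallyEtale_symm_D_algebraMap F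
    (Polynomial F) K Polynomial.X
  rw [hX] at this
  simp [l, e, this]

open IntermediateField in
/-- Two `σ`-twisted derivations of a field algebraic over `F(t)` agree if they agree at `t`. -/
theorem twist_eq_of_apply_eq [CharZero F] {M : Type*} [Field M] [Algebra F M] (σ : K →ₐ[F] M)
    (D : Derivation F K K) (E : Derivation F M M) {p q : M} {t : K} [Algebra.IsAlgebraic F⟮t⟯ K]
    (ht : p * σ (D t) = q * E (σ t)) (x : K) : p * σ (D x) = q * E (σ x) := by
  let : Algebra K M := σ.toRingHom.toAlgebra
  have : IsScalarTower F K M := IsScalarTower.of_algebraMap_eq fun r => (σ.commutes r).symm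
  let δ : Derivation F K M := Derivation.mk'
    { toFun := fun x => p * σ (D x) - q * E (σ x)
      map_add' := fun x y => by simp only [map_add]; ring
      map_smul' := fun r x => by
        have h : ∀ y : K, σ (r • y) = r • σ y := fun y => _root_.map_smul σ r y
        rw [D.map_smul, h, h, E.map_smul, RingHom.id_apply, smul_sub, mul_smul_comm,
          mul_smul_comm] }
    (fun a b => by
      change p * σ (D (a * b)) - q * E (σ (a * b)) =
        σ a * (p * σ (D b) - q * E (σ b)) + σ b * (p * σ (D a) - q * E (σ a))
      simp only [D.leibniz, E.leibniz, map_mul, map_add, smul_eq_mul]; ring)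
  have hδ : δ = 0 := δ.eq_zero_of_isAlgebraic_adjoin_simple (t := t) (sub_eq_zero.2 ht)
  exact sub_eq_zero.1 (congrArg (fun d => d x) hδ)

/-- If the logarithmic derivatives `g i` of the `a i` are constants and the sums `∑ m i * g i` are
distinct for distinct exponents `m`, then the `a i` are algebraically independent. -/
theorem algebraicIndependent_of_injective {ι : Type*} (D : Derivation F K K) {a : ι → K}
    {g : ι → F} (ha : ∀ i, a i ≠ 0) (hD : ∀ i, D (a i) = g i • a i)
    (hinj : Function.Injective fun m : ι →₀ ℕ => m.sum fun i k => (k : F) * g i) :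
    AlgebraicIndependent F a := by
  have hmon : ∀ m : ι →₀ ℕ, D (m.prod fun i k => a i ^ k) =
      (m.sum fun i k => (k : F) * g i) • m.prod fun i k => a i ^ k := by
    intro m
    classical
    induction m using Finsupp.induction_linear with
    | zero => simp
    | add m m' h h' =>
      rw [Finsupp.prod_add_index' (by simp) (by intros; rw [pow_add]),
        Finsupp.sum_add_index' (by simp) (by intros; push_cast; ring), D.leibniz, h, h',
        smul_eq_mul, smul_eq_mul, Algebra.smul_def, Algebra.smul_def, Algebra.smul_def, map_add]
      ring
    | single i k =>
      rw [Finsupp.prod_single_index (by simp), Finsupp.sum_single_index (by simp), D.leibniz_pow,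
        hD]
      rcases k with - | k
      · simp
      · simp only [nsmul_eq_mul, smul_eq_mul, Nat.add_sub_cancel]
        rw [Algebra.smul_def, Algebra.smul_def, map_mul, _root_.map_natCast (algebraMap F K)]
        ring
  -- Monomials are eigenvectors of D with pairwise distinct eigenvalues.
  have hli : LinearIndependent F fun m : ι →₀ ℕ => m.prod fun i k => a i ^ k :=
    Module.End.eigenvectors_linearIndependent' D.toLinearMap _ hinj _ fun m =>
      ⟨Module.End.mem_eigenspace_iff.2 (hmon m),
        Finset.prod_ne_zero_iff.2 fun i _ => pow_ne_zero _ (ha i)⟩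
  have key : (fun m : ι →₀ ℕ => m.prod fun i k => a i ^ k) =
      (MvPolynomial.aeval (R := F) a).toLinearMap ∘ MvPolynomial.basisMonomials ι F := by
    ext m; simp [MvPolynomial.aeval_monomial]
  rw [key, linearIndependent_iff] at hli
  refine (injective_iff_map_eq_zero _).2 fun p hp => ?_
  have := hli ((MvPolynomial.basisMonomials ι F).repr p)
  rw [← Finsupp.apply_linearCombination, Module.Basis.linearCombination_repr] at this
  simpa using this hp

end Derivation

/-! ### Degree counts -/

namespace IntermediateField

variable {F K : Type*} [Field F] [Field K] [Algebra F K]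

/-- `[F(t) : F(tⁿ)] = n` for `t` transcendental over `F`. -/
theorem relfinrank_adjoin_pow {t : K} (ht : Transcendental F t) (n : ℕ) :
    relfinrank F⟮t ^ n⟯ F⟮t⟯ = n := by
  have hinj : Function.Injective (Polynomial.aeval (R := F) t) :=
    transcendental_iff_injective.1 ht
  -- The degree is computed in F(X) ≅ F(t), as that of X^n as a rational function. For n = 0 the
  -- infinite degree reads as 0.
  let φ : RatFunc F →ₐ[F] K := RatFunc.liftAlgHom (Polynomial.aeval t)
    (nonZeroDivisors_le_comap_nonZeroDivisors_of_injective _ hinj)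
  have hφ : φ RatFunc.X = t := by
    rw [← RatFunc.algebraMap_X]
    have := RatFunc.liftAlgHom_apply_div (Polynomial.aeval t)
      (nonZeroDivisors_le_comap_nonZeroDivisors_of_injective _ hinj) Polynomial.X 1
    simpa using this
  have h1 : F⟮t⟯ = F⟮(RatFunc.X : RatFunc F)⟯.map φ := by
    rw [adjoin_map, Set.image_singleton, hφ]
  have h2 : F⟮t ^ n⟯ = F⟮(RatFunc.X : RatFunc F) ^ n⟯.map φ := by
    rw [adjoin_map, Set.image_singleton, map_pow, hφ]
  have h3 : (RatFunc.X : RatFunc F) ^ n =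
      algebraMap (Polynomial F) (RatFunc F) (Polynomial.X ^ n) := by
    rw [map_pow, RatFunc.algebraMap_X]
  rw [h1, h2, relfinrank_map_map, RatFunc.adjoin_X, relfinrank_top_right,
    RatFunc.finrank_eq_max_natDegree, h3, RatFunc.num_algebraMap, RatFunc.denom_algebraMap]
  simp

/-- Finitely generated and algebraic over F(t) means finite. Since an infinite degree reads as 0,
this is what permits cancelling degrees. -/
theorem relfinrank_adjoin_ne_zero (hK : Algebra.trdeg F K ≤ 1) {t : K} (ht : Transcendental F t)
    {S : Set K} (hS : S.Finite) (htS : t ∈ adjoin F S) : relfinrank F⟮t⟯ (adjoin F S) ≠ 0 := by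
  have := ht.isAlgebraic_adjoin_simple_of_trdeg_le_one hK
  have hle : F⟮t⟯ ≤ adjoin F S := adjoin_simple_le_iff.2 htS
  rw [relfinrank_eq_finrank_of_le hle, extendScalars_adjoin hle]
  have := hS.to_subtype
  have : FiniteDimensional F⟮t⟯ (adjoin F⟮t⟯ S) :=
    finiteDimensional_adjoin fun x _ => Algebra.IsIntegral.isIntegral x
  exact Module.finrank_pos.ne'

/-- Comparison of the degrees of `F(t, g)` over `F(tⁿ, g)` and over its image under `σ`. -/
theorem eq_of_algHom_pow_eq_pow (hK : Algebra.trdeg F K ≤ 1) (σ : K →ₐ[F] K) {t g : K}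
    (ht : Transcendental F t) (hg : Transcendental F g) {n c : ℕ}
    (hσt : σ (t ^ n) = t ^ c) (hσg : F⟮σ g⟯ = F⟮g⟯) : c = n := by
  set M := adjoin F {t, g} with hM
  set A := adjoin F {t ^ n, g} with hA
  have htM : t ∈ M := subset_adjoin _ _ (by simp)
  have hgM : g ∈ M := subset_adjoin _ _ (by simp)
  have htA : t ^ n ∈ A := subset_adjoin _ _ (by simp)
  have hgA : g ∈ A := subset_adjoin _ _ (by simp)
  have hAM : A ≤ M := by
    rw [hA, adjoin_le_iff]
    rintro x (rfl | rfl)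
    exacts [pow_mem htM n, hgM]
  have hσA : A.map σ = adjoin F {t ^ c, σ g} := by
    rw [hA, adjoin_map, Set.image_pair, hσt]
  have hσAM : A.map σ ≤ M := by
    rw [hσA, adjoin_le_iff]
    rintro x (rfl | rfl)
    · exact pow_mem htM c
    · exact (hσg ▸ adjoin_simple_le_iff.2 hgM : F⟮σ g⟯ ≤ M) (mem_adjoin_simple_self F _)
  have hmap : ∀ y ∈ A, relfinrank F⟮σ y⟯ (A.map σ) = relfinrank F⟮y⟯ A := fun y hy => by
    rw [← relfinrank_map_map F⟮y⟯ A σ, adjoin_map F {y}, Set.image_singleton]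
  have hchain : ∀ y ∈ A, relfinrank F⟮y⟯ A * relfinrank A M = relfinrank F⟮y⟯ M ∧
      relfinrank F⟮y⟯ A * relfinrank (A.map σ) M = relfinrank F⟮σ y⟯ M := fun y hy =>
    ⟨relfinrank_mul_relfinrank (adjoin_simple_le_iff.2 hy) hAM, by
      rw [← hmap y hy]
      exact relfinrank_mul_relfinrank
        (adjoin_simple_le_iff.2 ((mem_map _).2 ⟨y, hy, rfl⟩)) hσAM⟩
  have hg0 : relfinrank F⟮g⟯ M ≠ 0 := relfinrank_adjoin_ne_zero hK hg (Set.toFinite _) hgM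
  have ht0 : relfinrank F⟮t⟯ M ≠ 0 := relfinrank_adjoin_ne_zero hK ht (Set.toFinite _) htM
  -- Both towers start at F(g) = F(σ g), and σ preserves the degree of the lower step.
  have hAσA : relfinrank A M = relfinrank (A.map σ) M := by
    obtain ⟨h1, h2⟩ := hchain g hgA
    rw [hσg] at h2
    exact Nat.eq_of_mul_eq_mul_left
      (Nat.pos_of_ne_zero (left_ne_zero_of_mul (h1.trans_ne hg0))) (h1.trans h2.symm)
  obtain ⟨h1, h2⟩ := hchain _ htA
  rw [hσt, ← hAσA, h1] at h2
  have hpow : ∀ m, m * relfinrank F⟮t⟯ M = relfinrank F⟮t ^ m⟯ M := fun m => by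
    rw [← relfinrank_mul_relfinrank
      (adjoin_simple_le_iff.2 (pow_mem (mem_adjoin_simple_self F t) m))
      (adjoin_simple_le_iff.2 htM), relfinrank_adjoin_pow ht]
  rw [← hpow, ← hpow] at h2
  exact (Nat.eq_of_mul_eq_mul_right (Nat.pos_of_ne_zero ht0) h2).symm

end IntermediateField

/-! ### Logarithmic derivatives and the field case -/

namespace Derivation

variable {F K : Type*} [Field F] [Field K] [Algebra F K]

theorem apply_pow_of_apply_eq_mul (D : Derivation F K K) {x r : K} (h : D x = r * x) (n : ℕ) :
    D (x ^ n) = n * r * x ^ n := by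
  rw [D.leibniz_pow, h, smul_eq_mul, nsmul_eq_mul]
  rcases n with - | n
  · simp
  · rw [Nat.add_sub_cancel, pow_succ]; ring

/-- In transcendence degree one, the ratio of the logarithmic derivatives of two multiplicatively
independent elements is not a constant. -/
theorem apply_ne_zero_of_isAlgebraic_zpow_mul_zpow [CharZero F]
    (hK : Algebra.trdeg F K ≤ 1)
    (D : Derivation F K K) {x y r : K} (hx0 : x ≠ 0) (hy0 : y ≠ 0) (hx : D x = r * x) (hy : D y = y)
    (hxy : ∀ e f : ℤ, IsAlgebraic F (x ^ e * y ^ f) → e = 0 ∧ f = 0) : D r ≠ 0 := by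
  intro hr
  have hmon : ∀ i j : ℕ, D (x ^ i * y ^ j) = (i * r + j) * (x ^ i * y ^ j) := fun i j => by
    rw [D.leibniz, D.apply_pow_of_apply_eq_mul hx,
      D.apply_pow_of_apply_eq_mul (hy.trans (one_mul y).symm), smul_eq_mul, smul_eq_mul]
    ring
  -- Two monomials with the same eigenvalue have a quotient killed by D. It is algebraic, as
  -- otherwise D would vanish on K although D y = y ≠ 0.
  have key : ∀ i j i' j' : ℕ, (i * r + j : K) = i' * r + j' → i = i' ∧ j = j' := by
    intro i j i' j' h
    have hu : ∀ i j : ℕ, x ^ i * y ^ j ≠ 0 := fun i j =>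
      mul_ne_zero (pow_ne_zero _ hx0) (pow_ne_zero _ hy0)
    have hD : D ((x ^ i * y ^ j) / (x ^ i' * y ^ j')) = 0 := by
      rw [D.leibniz_div, hmon, hmon, h, smul_eq_mul, smul_eq_mul, smul_eq_mul]
      ring
    have halg : IsAlgebraic F ((x ^ i * y ^ j) / (x ^ i' * y ^ j')) := by
      by_contra hu
      have := Transcendental.isAlgebraic_adjoin_simple_of_trdeg_le_one hu hK
      rw [D.eq_zero_of_isAlgebraic_adjoin_simple hD] at hy
      exact hy0 hy.symm
    have := hxy (i - i') (j - j') (by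
      rw [zpow_sub₀ hx0, zpow_sub₀ hy0]
      simp only [zpow_natCast]
      rwa [div_mul_div_comm])
    omega
  -- The eigenvalues involve r, so independence is proved over the constants, where r lies, and then
  -- restricted to F.
  let L := D.constants
  have hind : AlgebraicIndependent L ![x, y] := by
    refine (D.extendConstants L le_rfl).algebraicIndependent_of_injective
      (g := ![⟨r, hr⟩, 1]) ?_ ?_ ?_
    · simp [Fin.forall_fin_two, hx0, hy0]
    · rw [Fin.forall_fin_two]
      exact ⟨hx, hy.trans (one_smul L y).symm⟩
    · intro m m' h
      have h' : (m 0 * r + m 1 : K) = m' 0 * r + m' 1 := by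
        have := congrArg (Subtype.val : L → K) h
        simpa [Finsupp.sum_fintype] using this
      ext i
      fin_cases i
      exacts [(key _ _ _ _ h').1, (key _ _ _ _ h').2]
  have h2 := (hind.restrictScalars (R := F)
    (algebraMap F L).injective).lift_cardinalMk_le_trdeg
  have h3 := h2.trans (Cardinal.lift_le.2 hK)
  simp at h3

end Derivation

/-- Homothety rigidity for an endomorphism of a field of transcendence degree one. -/
theorem AlgHom.eq_of_forall_pow_eq_pow {F K ι : Type*} [Field F] [CharZero F] [Field K]
    [Algebra F K] (hK : Algebra.trdeg F K ≤ 1) (σ : K →ₐ[F] K) {a : ι → K} (ha : ∀ i, Transcendental F (a i))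
    {n : ℕ} {c : ι → ℕ} (hn : n ≠ 0) (hc : ∀ i, c i ≠ 0) (hσ : ∀ i, σ (a i ^ n) = a i ^ c i)
    {j k : ι} (hjk : ∀ e f : ℤ, IsAlgebraic F (a j ^ e * a k ^ f) → e = 0 ∧ f = 0) (i : ι) :
    c i = n := by
  have := charZero_of_injective_algebraMap (algebraMap F K).injective
  have ha0 : ∀ i, a i ≠ 0 := fun i h => ha i (h ▸ isAlgebraic_zero)
  obtain ⟨D₀, hD₀⟩ := Derivation.exists_apply_eq_one hK (ha k)
  let D : Derivation F K K := a k • D₀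
  have hk : D (a k) = a k := by simp [D, hD₀]
  obtain ⟨r, hj⟩ : ∃ r, D (a j) = r * a j := ⟨D (a j) / a j, (div_mul_cancel₀ _ (ha0 j)).symm⟩
  have hDr : D r ≠ 0 :=
    D.apply_ne_zero_of_isAlgebraic_zpow_mul_zpow hK (ha0 j) (ha0 k) hj hk hjk
  have hrt : Transcendental F r := fun h => hDr (D.apply_eq_zero_of_isAlgebraic h)
  have hkn : Transcendental F (a k ^ n) := (ha k).pow (Nat.pos_of_ne_zero hn)
  have := hkn.isAlgebraic_adjoin_simple_of_trdeg_le_one hK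
  have hpk := D.apply_pow_of_apply_eq_mul (hk.trans (one_mul _).symm)
  have hpj := D.apply_pow_of_apply_eq_mul hj
  -- The weights `c k` and `n` make c_k σD and n Dσ agree at a_k^n; they then agree at a_j^n.
  have htw := Derivation.twist_eq_of_apply_eq σ D D (p := c k) (q := n) (t := a k ^ n) (by
    rw [hσ, hpk, hpk, map_mul, map_mul, hσ, map_natCast, map_one]; ring) (a j ^ n)
  rw [hσ, hpj, hpj, map_mul, map_mul, hσ, map_natCast] at htw
  have hσr : σ r = ((c j : F) / c k) • r := by
    have hnK : (n : K) ≠ 0 := Nat.cast_ne_zero.2 hn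
    have hkK : (c k : K) ≠ 0 := Nat.cast_ne_zero.2 (hc k)
    have := pow_ne_zero (c j) (ha0 j)
    rw [Algebra.smul_def, map_div₀, map_natCast, map_natCast]
    field_simp
    refine mul_right_cancel₀ (mul_ne_zero hnK this) ?_
    linear_combination htw
  refine IntermediateField.eq_of_algHom_pow_eq_pow hK σ (ha i) hrt (hσ i) ?_
  have hq : ((c j : F) / c k) ≠ 0 :=
    div_ne_zero (Nat.cast_ne_zero.2 (hc j)) (Nat.cast_ne_zero.2 (hc k))
  rw [hσr]
  refine le_antisymm ?_ ?_ <;> rw [IntermediateField.adjoin_simple_le_iff]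
  · exact IntermediateField.smul_mem _ (IntermediateField.mem_adjoin_simple_self F r)
  · have := IntermediateField.smul_mem _ (x := ((c j : F) / c k)⁻¹)
      (IntermediateField.mem_adjoin_simple_self F (((c j : F) / c k) • r))
    rwa [inv_smul_smul₀ hq] at this

/-! ### Krull dimension and transcendence degree -/

theorem Int.isJacobsonRing : IsJacobsonRing ℤ := by
  refine isJacobsonRing_iff_prime_eq.2 fun P hP => ?_
  rcases eq_or_ne P ⊥ with rfl | hP0
  · refine eq_bot_iff.2 fun x hx => Ideal.mem_bot.2 ?_
    -- For x in the Jacobson radical x·x + 1 is ±1, which forces x = 0.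
    rcases Int.isUnit_iff.1 (Ideal.mem_jacobson_bot.1 hx x) with h | h <;> nlinarith
  · have := IsPrime.to_maximal_ideal hP0
    exact Ideal.jacobson_eq_self_of_isMaximal

/-- A maximal ideal of a finitely generated ring contains a non-zero integer. -/
theorem Ideal.IsMaximal.comap_algebraMap_int_ne_bot {A : Type*} [CommRing A]
    [Algebra.FiniteType ℤ A] {P : Ideal A} (hP : P.IsMaximal) :
    P.comap (algebraMap ℤ A) ≠ ⊥ := by
  intro h
  let := Ideal.Quotient.field P
  have := Int.isJacobsonRing
  -- By the Nullstellensatz over ℤ the residue field is finite over ℤ; if ℤ embedded in it, ℤ would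
  -- be a field.
  have : Module.Finite ℤ (A ⧸ P) := finite_of_finite_type_of_isJacobsonRing ℤ (A ⧸ P)
  have hinj : Function.Injective (algebraMap ℤ (A ⧸ P)) := by
    rw [injective_iff_map_eq_zero]
    intro z hz
    rw [IsScalarTower.algebraMap_apply ℤ A (A ⧸ P), Ideal.Quotient.algebraMap_eq,
      Ideal.Quotient.eq_zero_iff_mem] at hz
    exact (Ideal.mem_bot.1 (h ▸ Ideal.mem_comap.2 hz : z ∈ (⊥ : Ideal ℤ)))
  exact Int.not_isField (isField_of_isIntegral_of_isField hinj (Field.toIsField (A ⧸ P)))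

/-- Two comparable distinct non-zero primes in an integral extension of a domain of Krull dimension
at least two. -/
theorem exists_isPrime_lt_of_two_le_ringKrullDim {R B : Type*} [CommRing R] [CommRing B]
    [IsDomain B] [Algebra R B] [FaithfulSMul R B] [Algebra.IsIntegral R B] (h : 2 ≤ ringKrullDim R) :
    ∃ P Q : Ideal B, P.IsPrime ∧ Q.IsPrime ∧ ⊥ < P ∧ P < Q := by
  obtain ⟨l, hl⟩ := Order.le_krullDim_iff.1 (show ((2 : ℕ) : WithBot ℕ∞) ≤ ringKrullDim R from h)
  let p : Fin 3 → PrimeSpectrum R := fun i => l (i.cast (by rw [hl]))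
  have hp : StrictMono p := l.strictMono.comp (Fin.cast_strictMono _)
  have h01 : p 0 < p 1 := hp (by decide)
  have h12 : p 1 < p 2 := hp (by decide)
  have hbot := Ideal.comap_bot_of_injective _ (FaithfulSMul.algebraMap_injective R B)
  obtain ⟨P, -, hP, hP1⟩ := Ideal.exists_ideal_over_prime_of_isIntegral (S := B)
    (p 1).asIdeal ⊥ (hbot.trans_le bot_le)
  obtain ⟨Q, hPQ, hQ, hQ2⟩ := Ideal.exists_ideal_over_prime_of_isIntegral
    (p 2).asIdeal P (hP1.trans_le h12.le)
  refine ⟨P, Q, hP, hQ, bot_lt_iff_ne_bot.2 ?_, lt_of_le_of_ne hPQ ?_⟩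
  · rintro rfl
    have : (p 0).asIdeal < ⊥ := hbot ▸ hP1 ▸ h01
    exact not_lt_bot this
  · rintro rfl
    exact h12.ne (PrimeSpectrum.ext (hP1.symm.trans hQ2))

/-- A finitely generated domain of characteristic zero and Krull dimension at most two has
transcendence degree at most one over `ℚ`. -/
theorem Algebra.trdeg_le_one_of_ringKrullDim_le_two {A K : Type*} [CommRing A] [IsDomain A]
    [Algebra.FiniteType ℤ A] [Field K] [CharZero K] [Algebra A K] [IsFractionRing A K]
    (h : ringKrullDim A ≤ 2) : Algebra.trdeg ℚ K ≤ 1 := by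
  have hAK : Function.Injective (algebraMap A K) := IsFractionRing.injective A K
  obtain ⟨S, hS⟩ := (inferInstance : Algebra.FiniteType ℤ A).out
  -- B is A with the non-zero integers inverted, so contraction to A keeps strict inclusions of
  -- ideals.
  let B := Algebra.adjoin ℚ (algebraMap A K '' S)
  have : Algebra.FiniteType ℚ B :=
    (Subalgebra.fg_iff_finiteType B).1 (Subalgebra.fg_def.2 ⟨_, S.finite_toSet.image _, rfl⟩)
  have hAB : ∀ a : A, algebraMap A K a ∈ B := by
    intro a
    have ha : a ∈ Algebra.adjoin ℤ (S : Set A) := hS ▸ Algebra.mem_top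
    induction ha using Algebra.adjoin_induction with
    | mem x hx => exact Algebra.subset_adjoin ⟨x, hx, rfl⟩
    | algebraMap z => rw [eq_intCast, map_intCast]; exact intCast_mem B z
    | add x y _ _ hx hy => rw [map_add]; exact add_mem hx hy
    | mul x y _ _ hx hy => rw [map_mul]; exact mul_mem hx hy
  let ι : A →+* B := (algebraMap A K).codRestrict B hAB
  have hden : ∀ b ∈ B, ∃ N : ℕ, N ≠ 0 ∧ ∃ a, algebraMap A K a = N * b := by
    intro b hb
    induction hb using Algebra.adjoin_induction with
    | mem x hx =>
      obtain ⟨a, -, rfl⟩ := hx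
      exact ⟨1, one_ne_zero, a, by simp⟩
    | algebraMap q =>
      refine ⟨q.den, q.den_ne_zero, q.num, ?_⟩
      rw [map_intCast, eq_ratCast]
      exact_mod_cast (Rat.den_mul_eq_num q).symm
    | add x y _ _ hx hy =>
      obtain ⟨N, hN, a, ha⟩ := hx
      obtain ⟨N', hN', a', ha'⟩ := hy
      refine ⟨N * N', mul_ne_zero hN hN', N' * a + N * a', ?_⟩
      simp only [map_add, map_mul, map_natCast, ha, ha', Nat.cast_mul]
      ring
    | mul x y _ _ hx hy =>
      obtain ⟨N, hN, a, ha⟩ := hx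
      obtain ⟨N', hN', a', ha'⟩ := hy
      refine ⟨N * N', mul_ne_zero hN hN', a * a', ?_⟩
      simp only [map_mul, ha, ha', Nat.cast_mul]
      ring
  have hcomap : ∀ P Q : Ideal B, P < Q → P.comap ι < Q.comap ι := by
    intro P Q hPQ
    obtain ⟨b, hbQ, hbP⟩ := SetLike.exists_of_lt hPQ
    obtain ⟨N, hN, a, ha⟩ := hden b b.2
    have hιa : ι a = (N : ℚ) • b := Subtype.ext (by
      change algebraMap A K a = (N : ℚ) • (b : K)
      rw [ha, Algebra.smul_def, map_natCast])
    refine lt_of_le_of_ne (Ideal.comap_mono hPQ.le) fun heq => hbP ?_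
    have haQ : a ∈ Q.comap ι := by
      rw [Ideal.mem_comap, hιa]; exact Submodule.smul_of_tower_mem Q _ hbQ
    rw [← heq, Ideal.mem_comap, hιa] at haQ
    have := Submodule.smul_of_tower_mem P (N : ℚ)⁻¹ haQ
    rwa [inv_smul_smul₀ (Nat.cast_ne_zero.2 hN)] at this
  obtain ⟨s, g, hginj, hgint⟩ := exists_integral_inj_algHom_of_fg ℚ B
  let : Algebra (MvPolynomial (Fin s) ℚ) B := g.toRingHom.toAlgebra
  have : IsScalarTower ℚ (MvPolynomial (Fin s) ℚ) B :=
    IsScalarTower.of_algebraMap_eq fun r => (g.commutes r).symm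
  have : FaithfulSMul (MvPolynomial (Fin s) ℚ) B :=
    (faithfulSMul_iff_algebraMap_injective _ _).2 hginj
  have : Algebra.IsIntegral (MvPolynomial (Fin s) ℚ) B := ⟨hgint⟩
  have hs : s ≤ 1 := by
    by_contra! hs
    obtain ⟨P, Q, hP, hQ, h0P, hPQ⟩ :=
      exists_isPrime_lt_of_two_le_ringKrullDim (R := MvPolynomial (Fin s) ℚ) (B := B) (by
        rw [MvPolynomial.ringKrullDim_of_isNoetherianRing, ringKrullDim_eq_zero_of_field, zero_add,
          Nat.card_fin]
        exact_mod_cast hs)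
    have h1 := hcomap _ _ h0P
    have h2 := hcomap _ _ hPQ
    have hP' := hP.comap ι
    have hQ' := hQ.comap ι
    obtain ⟨m, hm, hQm⟩ := Ideal.exists_le_maximal _ hQ'.ne_top
    have hQint : (Q.comap ι).comap (algebraMap ℤ A) = ⊥ := by
      rw [eq_bot_iff]
      intro z hz
      by_contra hz0
      refine hQ.ne_top (Ideal.eq_top_of_isUnit_mem _ (Ideal.mem_comap.1 (Ideal.mem_comap.1 hz)) ?_)
      rw [eq_intCast, map_intCast, ← map_intCast (algebraMap ℚ B)]
      exact (IsUnit.mk0 _ (Int.cast_ne_zero.2 hz0)).map _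
    -- Q contracts to zero in ℤ but m does not. This gives the extra step of a chain of length 3 in
    -- A.
    have h3 : Q.comap ι < m := lt_of_le_of_ne hQm fun heq =>
      (heq ▸ hm : (Q.comap ι).IsMaximal).comap_algebraMap_int_ne_bot hQint
    let l : LTSeries (PrimeSpectrum A) :=
      { length := 3
        toFun := ![⟨⊥, Ideal.isPrime_bot⟩, ⟨P.comap ι, hP'⟩, ⟨Q.comap ι, hQ'⟩, ⟨m, hm.isPrime⟩]
        step := by
          intro i
          fin_cases i
          exacts [bot_le.trans_lt h1, h2, h3] }
    have h4 : ((3 : ℕ) : WithBot ℕ∞) ≤ 2 := (Order.LTSeries.length_le_krullDim l).trans h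
    exact absurd h4 (by decide)
  let : Algebra A B := ι.toAlgebra
  have : IsScalarTower A B K := IsScalarTower.of_algebraMap_eq fun _ => rfl
  have : Algebra.IsAlgebraic A K := IsLocalization.isAlgebraic (R := A) (S := K) (nonZeroDivisors A)
  have : Algebra.IsAlgebraic B K := Algebra.IsAlgebraic.extendScalars (R := A)
    fun a b hab => hAK (congrArg Subtype.val hab)
  have hbasis := ((IsTranscendenceBasis.mvPolynomial (Fin s) ℚ).algebraMap_comp
    (A := B)).algebraMap_comp (A := K)
  have hcard := hbasis.lift_cardinalMk_eq_trdeg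
  rw [Cardinal.mk_fin, Cardinal.lift_natCast, Cardinal.lift_id'.{0}] at hcard
  rw [← hcard]
  exact_mod_cast hs

/-! ### From rings to algebraically closed fields -/

/-- A homomorphism from a domain of transcendence degree at most one is injective as soon as its
image contains a transcendental element. -/
theorem AlgHom.injective_of_trdeg_le_one {k R S : Type*} [CommRing k] [Nontrivial k] [CommRing R]
    [IsDomain R] [CommRing S] [Algebra k R] [Algebra k S] (h : Algebra.trdeg k R ≤ 1)
    (g : R →ₐ[k] S) {t : R} (ht : Transcendental k (g t)) : Function.Injective g := by
  have htR : Transcendental k t := fun h => ht (h.algHom g)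
  have hbasis := (htR.isTranscendenceBasis_of_trdeg_le_one h).isAlgebraic
  rw [Set.range_const] at hbasis
  refine (RingHom.injective_iff_ker_eq_bot g.toRingHom).2 (by_contra fun hker => ?_)
  obtain ⟨x, hx, hx0⟩ := Submodule.exists_mem_ne_zero_of_ne_bot hker
  -- A non-zero kernel element is algebraic over k[t], so the kernel meets k[t] non-trivially,
  -- against the transcendence of g t.
  refine Ideal.comap_ne_bot_of_algebraic_mem hx0 hx (hbasis.isAlgebraic x) ?_
  rw [eq_bot_iff]
  rintro ⟨y, hy⟩ hgy
  obtain ⟨p, rfl⟩ := (Algebra.adjoin_singleton_eq_range_aeval k t ▸ hy :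
    y ∈ (Polynomial.aeval (R := k) t).range)
  have hp : Polynomial.aeval (g t) p = 0 := by
    rw [Polynomial.aeval_algHom_apply]; exact hgy
  have := (transcendental_iff.1 ht) p hp
  subst this
  exact Ideal.mem_bot.2 (Subtype.ext (map_zero _))

/-- The maps are kept explicit because L and M will be the same field with two different R-algebra
structures. -/
theorem IsAlgClosed.exists_ringHom_extending {R L M : Type*} [CommRing R] [Field L] [Field M]
    [IsAlgClosed M] {f : R →+* L} {g : R →+* M} (hf : Function.Injective f)
    (hg : Function.Injective g) (halg : @Algebra.IsAlgebraic R L _ _ f.toAlgebra) :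
    ∃ σ : L →+* M, ∀ r, σ (f r) = g r := by
  let := f.toAlgebra
  let := g.toAlgebra
  have : IsDomain R := hf.isDomain f
  have : FaithfulSMul R L := (faithfulSMul_iff_algebraMap_injective _ _).2 hf
  have : FaithfulSMul R M := (faithfulSMul_iff_algebraMap_injective _ _).2 hg
  exact ⟨(IsAlgClosed.lift : L →ₐ[R] M).toRingHom, (IsAlgClosed.lift : L →ₐ[R] M).commutes⟩

/-- ℚ is algebraic over ℤ. This lets degrees be compared with subrings that need not contain ℚ. -/
theorem Algebra.trdeg_int_eq_trdeg_rat (K : Type*) [Field K] [CharZero K] :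
    Algebra.trdeg ℤ K = Algebra.trdeg ℚ K := by
  have := lift_trdeg_add_eq ℤ ℚ K
  have h0 : Algebra.IsAlgebraic ℤ ℚ :=
    IsLocalization.isAlgebraic (R := ℤ) (S := ℚ) (nonZeroDivisors ℤ)
  rw [_root_.trdeg_eq_zero] at this
  simpa using this.symm

/-- The algebraic closure of K is algebraic over f(R), which contains the transcendental a_i^n;
hence g extends along f to an endomorphism, and the field case applies. -/
theorem RingHom.eq_of_forall_pow_eq_pow {R K ι : Type*} [CommRing R] [Field K] [CharZero K]
    (hK : Algebra.trdeg ℚ K ≤ 1) {f g : R →+* K} (hf : Function.Injective f) {r : ι → R} {a : ι → K}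
    (ha : ∀ i, Transcendental ℚ (a i)) {n : ℕ} {c : ι → ℕ} (hn : n ≠ 0) (hc : ∀ i, c i ≠ 0)
    (hfr : ∀ i, f (r i) = a i ^ n) (hgr : ∀ i, g (r i) = a i ^ c i)
    {j k : ι} (hjk : ∀ e f : ℤ, IsAlgebraic ℚ (a j ^ e * a k ^ f) → e = 0 ∧ f = 0) (i : ι) :
    c i = n := by
  have : IsDomain R := hf.isDomain f
  let Ω := AlgebraicClosure K
  have hΩ : Algebra.trdeg ℚ Ω ≤ 1 := by
    rw [← trdeg_add_eq ℚ K, trdeg_eq_zero (R := K) (A := Ω), add_zero]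
    exact hK
  have hR : Algebra.trdeg ℤ R ≤ 1 := by
    have := lift_trdeg_le_of_injective f.toIntAlgHom hf
    rw [Algebra.trdeg_int_eq_trdeg_rat] at this
    simpa using this.trans (Cardinal.lift_le.2 hK)
  have hint : ∀ {L : Type _} [Field L] [CharZero L] {y : L}, Transcendental ℚ y →
    Transcendental ℤ y := fun hy h =>
      hy (h.extendScalars (algebraMap ℤ ℚ).injective_int)
  have hg : Function.Injective g :=
    AlgHom.injective_of_trdeg_le_one hR g.toIntAlgHom (t := r i)
      (hint (by
        change Transcendental ℚ (g (r i))
        rw [hgr]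
        exact (ha i).pow (Nat.pos_of_ne_zero (hc i))))
  let ε := algebraMap K Ω
  have hε : Function.Injective ε := ε.injective
  have haΩ : ∀ i, Transcendental ℚ (ε (a i)) := fun i =>
    (transcendental_algebraMap_iff hε).2 (ha i)
  have halg : @Algebra.IsAlgebraic R Ω _ _ (ε.comp f).toAlgebra := by
    let := (ε.comp f).toAlgebra
    have ht : Transcendental ℤ (ε (a i) ^ n) := hint ((haΩ i).pow (Nat.pos_of_ne_zero hn))
    refine (ht.isTranscendenceBasis_of_trdeg_le_one
      ((Algebra.trdeg_int_eq_trdeg_rat Ω).trans_le hΩ)).isAlgebraic_iff.2 fun _ => ?_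
    rw [← map_pow, ← hfr]
    exact isAlgebraic_algebraMap (r i)
  obtain ⟨σ, hσ⟩ := IsAlgClosed.exists_ringHom_extending (hε.comp hf) (hε.comp hg)
    (f := ε.comp f) (g := ε.comp g) halg
  refine AlgHom.eq_of_forall_pow_eq_pow hΩ σ.toRatAlgHom haΩ hn hc (fun i => ?_)
    (j := j) (k := k) (fun e f h => hjk e f ?_) i
  · have := hσ (r i)
    simp only [RingHom.comp_apply, hfr, hgr, map_pow] at this
    simpa using this
  · rw [← map_zpow₀, ← map_zpow₀, ← map_mul] at h
    exact (isAlgebraic_algebraMap_iff hε).1 h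

/-! ### Group rings and the theorem -/

section GroupRing

variable {Q : Type*} [CommGroup Q]

/-- The inclusion of `ℤH / (ℤH ∩ I)` into `ℤQ / I`. -/
noncomputable def SubQuot.inclusion (I : Ideal (MonoidAlgebra ℤ Q)) (H : Subgroup Q) :
    SubQuot I H →+* MonoidAlgebra ℤ Q ⧸ I :=
  Ideal.quotientMap I (MonoidAlgebra.mapDomainRingHom ℤ H.subtype) le_rfl

theorem SubQuot.inclusion_injective (I : Ideal (MonoidAlgebra ℤ Q)) (H : Subgroup Q) :
    Function.Injective (SubQuot.inclusion I H) :=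
  Ideal.quotientMap_injective

theorem SubQuot.inclusion_elt (I : Ideal (MonoidAlgebra ℤ Q)) (H : Subgroup Q) (h : H) :
    SubQuot.inclusion I H (SubQuot.elt I H h) =
      Ideal.Quotient.mk I (MonoidAlgebra.of ℤ Q h) := by
  refine (Ideal.quotientMap_mk (H := le_rfl)).trans (congrArg _ ?_)
  simp

/-- `s` generators of a free abelian group of rank `s` are independent. -/
theorem eq_zero_of_prod_zpow_eq_one_of_closure_eq_top {s : ℕ} (e : Q ≃* Multiplicative (Fin s → ℤ))
    {x : Fin s → Q} (hx : Subgroup.closure (Set.range x) = ⊤) {v : Fin s → ℤ}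
    (hv : ∏ i, x i ^ v i = 1) : v = 0 := by
  let T : (Fin s → ℤ) →+ (Fin s → ℤ) :=
    { toFun := fun v => (e (∏ i, x i ^ v i)).toAdd
      map_zero' := by simp
      map_add' := fun v w => by simp [zpow_add, Finset.prod_mul_distrib] }
  have hsurj : Function.Surjective T := by
    have hQ : ∀ q : Q, ∃ v : Fin s → ℤ, ∏ i, x i ^ v i = q := by
      intro q
      have hq : q ∈ Subgroup.closure (Set.range x) := hx ▸ Subgroup.mem_top q
      induction hq using Subgroup.closure_induction with
      | mem q hq =>
        obtain ⟨i, rfl⟩ := hq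
        refine ⟨Pi.single i 1, ?_⟩
        rw [Finset.prod_eq_single i (fun j _ hj => by simp [hj]) (by simp)]
        simp
      | one => exact ⟨0, by simp⟩
      | mul p q _ _ hp hq =>
        obtain ⟨v, rfl⟩ := hp
        obtain ⟨w, rfl⟩ := hq
        exact ⟨v + w, by simp [zpow_add, Finset.prod_mul_distrib]⟩
      | inv q _ hq =>
        obtain ⟨v, rfl⟩ := hq
        exact ⟨-v, by simp⟩
    intro w
    obtain ⟨v, hv⟩ := hQ (e.symm (Multiplicative.ofAdd w))
    exact ⟨v, (congrArg (fun q : Q => (e q).toAdd) hv).trans (by simp)⟩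
  -- A surjective endomorphism of a finitely generated module over a commutative ring is injective.
  have hinj := OrzechProperty.injective_of_surjective_endomorphism T.toIntLinearMap hsurj
  exact hinj (((congrArg (fun q : Q => (e q).toAdd) hv).trans (by simp)).trans (map_zero T).symm)

theorem rank_eq_of_mulEquiv {s t : ℕ} (e : Q ≃* Multiplicative (Fin s → ℤ))
    (e' : Q ≃* Multiplicative (Fin t → ℤ)) : s = t := by
  have := (AddEquiv.toMultiplicative.symm (e.symm.trans e')).toIntLinearEquiv.finrank_eq
  simpa using this

end GroupRing

theorem mainTheorem4 {Q : Type*} [CommGroup Q] (s : ℕ) (hs : 2 ≤ s)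
    (hQ : Nonempty (Q ≃* Multiplicative (Fin s → ℤ)))
    (I : Ideal (MonoidAlgebra ℤ Q))
    [IsDomain (MonoidAlgebra ℤ Q ⧸ I)] [CharZero (MonoidAlgebra ℤ Q ⧸ I)]
    (hdim : ringKrullDim (MonoidAlgebra ℤ Q ⧸ I) = 2)
    (halg : ∀ q : Q, q ≠ 1 →
      ¬ IsAlgebraicOverRat (Ideal.Quotient.mk I (MonoidAlgebra.of ℤ Q q))) :
    IsHomothetyRigid I := by
  rintro t ⟨e⟩ x hx n c hn hc ⟨φ, hφ⟩
  obtain ⟨e₀⟩ := hQ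
  obtain rfl := rank_eq_of_mulEquiv e₀ e
  let A := MonoidAlgebra ℤ Q ⧸ I
  let K := FractionRing A
  have : Group.FG Q := ⟨⟨(Set.finite_range x).toFinset, by simpa using hx⟩⟩
  have : @Algebra.FiniteType ℤ A _ _ (Ring.toIntAlgebra A) := by
    convert Algebra.FiniteType.of_surjective (Ideal.Quotient.mkₐ ℤ I) Ideal.Quotient.mk_surjective
    exact Subsingleton.elim _ _
  have hK : Algebra.trdeg ℚ K ≤ 1 := Algebra.trdeg_le_one_of_ringKrullDim_le_two (A := A) hdim.le
  let α : Q →* K := ((algebraMap A K).comp (Ideal.Quotient.mk I)).toMonoidHom.comp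
    (MonoidAlgebra.of ℤ Q)
  have hα : ∀ q, q ≠ 1 → Transcendental ℚ (α q) := halg
  have hind : ∀ v : Fin s → ℤ, ∏ i, x i ^ v i = 1 → v = 0 := fun v =>
    eq_zero_of_prod_zpow_eq_one_of_closure_eq_top e hx
  have hx1 : ∀ i, x i ≠ 1 := by
    intro i hi
    have := congrFun (hind (Pi.single i 1) (Finset.prod_eq_one fun j _ => by
      rcases eq_or_ne j i with rfl | hj
      · simp [hi]
      · simp [hj])) i
    simp at this
  let f : ∀ H, SubQuot I H →+* K := fun H => (algebraMap A K).comp (SubQuot.inclusion I H)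
  have hf : ∀ (H : Subgroup Q) (h : H), f H (SubQuot.elt I H h) = α h := fun H h =>
    congrArg (algebraMap A K) (SubQuot.inclusion_elt I H h)
  have hpow : ∀ (d : Fin s → ℕ) i, f _ (SubQuot.elt I _ (powElt x d i)) = α (x i) ^ d i :=
    fun d i => (hf _ _).trans (map_pow α (x i) (d i))
  -- Rank at least 2 supplies the two multiplicatively independent elements behind r.
  let j : Fin s := ⟨0, by omega⟩
  let k : Fin s := ⟨1, by omega⟩
  have hjk : j ≠ k := by simp [j, k]
  refine RingHom.eq_of_forall_pow_eq_pow hK (f := f (powSubgroup x fun _ => n))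
    (g := (f (powSubgroup x c)).comp φ)
    ((IsFractionRing.injective A K).comp (SubQuot.inclusion_injective I _))
    (r := fun i => SubQuot.elt I _ (powElt x (fun _ => n) i)) (a := fun i => α (x i))
    (fun i => hα _ (hx1 i)) hn.ne' (fun i => (hc i).ne') (fun i => hpow _ i)
    (fun i => (congrArg _ (hφ i)).trans (hpow c i)) (j := j) (k := k) fun u v huv => ?_
  rw [← map_zpow, ← map_zpow, ← map_mul] at huv
  have h1 : x j ^ u * x k ^ v = 1 := by_contra fun h => hα _ h huv
  have h2 := hind (Pi.single j u + Pi.single k v) (by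
    rw [← h1]
    simp only [Pi.add_apply, zpow_add, Finset.prod_mul_distrib]
    congr 1
    · rw [Finset.prod_eq_single j (fun i _ hi => by simp [hi]) (by simp)]; simp
    · rw [Finset.prod_eq_single k (fun i _ hi => by simp [hi]) (by simp)]; simp)
  have hj := congrFun h2 j
  have hk := congrFun h2 k
  simp only [Pi.add_apply, Pi.single_eq_same, Pi.single_eq_of_ne hjk, Pi.single_eq_of_ne hjk.symm,
    Pi.zero_apply, add_zero, zero_add] at hj hk
  exact ⟨hj, hk⟩
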